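/- Let $m$ be a number of divisible items, let $\bar v>0$ and $c_1,\dots,c_m>0$, and let $V=[0,\bar v]^m\setminus\{0\}$ be the set of possible valuations (and of possible reports). Let $\mathcal F$ be a probability distribution on $V$ with full support, i.e. every nonempty relatively open subset of $V$ has positive probability. In the market with $n$ individuals the supply of item $j$ is $s_j=c_jn$; an individual with valuation $v$ has utility $v\cdot x_i=\sum_j v_jx_{ij}$ from an allocation $x\in\mathbb R_+^{n\times m}$. A CEEI mechanism maps each profile of reports $(w_1,\dots,w_n)\in V^n$ (measurably) to a solution of the Eisenberg–Gale program with unit budgets, $$\max_{x\ge 0}\ \sum_{i=1}^n\log(w_i\cdot x_i)\quad\text{subject to}\quad \sum_i x_{ij}\le s_j\ \text{ for all } j,$$ where $\log 0=-\infty$ and ties between solutions are broken arbitrarily. A reporting strategy $\sigma$ is a measurable, possibly randomized, map from valuations in $V$ to reports in $V$. It has full range if the report of an individual whose type is drawn from $\mathcal F$ and who reports according to $\sigma$ has a distribution with full support on $V$. For an individual $i$ with true valuation $v_i$, the expected gain from reporting $v_i'$ is the expected utility (computed with $v_i$) of $i$'s bundle when $i$ reports $v_i'$, minus the expected utility when $i$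 reports $v_i$; here the other $n-1$ individuals have types drawn independently from $\mathcal F$ and report, independently of each other, according to $\sigma$. Theorem. For every $\sigma$ with full range there is a constant $C$, depending only on $m,\bar v,(c_j)_j,\mathcal F,\sigma$, such that for every $n$, every CEEI mechanism for $n$ individuals, every individual $i$ and all $v_i,v_i'\in V$, the expected gain from reporting $v_i'$ instead of $v_i$ is at most $C/n$. Hence CEEI is strategy-proof in the large: for every choice of a CEEI mechanism for each $n$, every $\sigma$ with full range and every $\epsilon>0$ there is $\bar n$ such that for all $n>\bar n$, all $i$ and all $v_i,v_i'\in V$, the expected gain from reporting $v_i'$ instead of $v_i$ is at most $\epsilon$. -/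

import Mathlib

open MeasureTheory ProbabilityTheory

noncomputable section

namespace CEEI

/-- Possible valuations of `m` items (and possible reports): the vectors of `[0, vbar]^m` other than
the zero vector, for which the Eisenberg-Gale objective `log (v ⬝ x)` is nowhere defined. -/
def valuations (m : ℕ) (vbar : ℝ) : Set (Fin m → ℝ) :=
  {v | (∀ j, 0 ≤ v j ∧ v j ≤ vbar) ∧ v ≠ 0}

/-- Utility of the bundle `x` for an individual with valuation `v`. -/
def utility {m : ℕ} (v x : Fin m → ℝ) : ℝ := ∑ j, v j * x j

/-- Nonnegative allocations of `m` divisible items with supplies `s` among `n` individuals. -/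
def IsFeasible {n m : ℕ} (s : Fin m → ℝ) (x : Fin n → Fin m → ℝ) : Prop :=
  (∀ i j, 0 ≤ x i j) ∧ ∀ j, ∑ i, x i j ≤ s j

/-- `x` solves the Eisenberg-Gale program with unit budgets for the valuation profile `w`:
maximize `∑ i, log (w i ⬝ x i)` over the feasible allocations. The positivity requirements express
`log 0 = -∞` (`Real.log 0 = 0` is a junk value). -/
def IsEisenbergGale {n m : ℕ} (s : Fin m → ℝ) (w x : Fin n → Fin m → ℝ) : Prop :=
  IsFeasible s x ∧ (∀ i, 0 < utility (w i) (x i)) ∧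
    ∀ y : Fin n → Fin m → ℝ, IsFeasible s y → (∀ i, 0 < utility (w i) (y i)) →
      ∑ i, Real.log (utility (w i) (y i)) ≤ ∑ i, Real.log (utility (w i) (x i))

/-- A direct mechanism for `n` individuals: it maps each profile of reports to bundles. -/
abbrev Mechanism (n m : ℕ) (vbar : ℝ) : Type :=
  (Fin n → valuations m vbar) → Fin n → Fin m → ℝ

/-- `M` is a CEEI mechanism for `n` individuals and supplies `s j = c j * n`: at every profile of
reports it picks an Eisenberg-Gale allocation (ties may be broken in any measurable way). -/
structure IsCEEI {n m : ℕ} {vbar : ℝ} (c : Fin m → ℝ) (M : Mechanism n m vbar) : Prop where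
  measurable : Measurable M
  optimal : ∀ r, IsEisenbergGale (fun j => c j * n) (fun i => (r i : Fin m → ℝ)) (M r)

/-- The reporting strategy `σ`, a possibly randomized map from valuations to reports, has full
range when types are drawn from `F`: the distribution of the report of a random individual gives
positive probability to every nonempty (relatively) open set of reports. -/
def FullRange {m : ℕ} {vbar : ℝ} (F : Measure (valuations m vbar))
    (σ : Kernel (valuations m vbar) (valuations m vbar)) : Prop :=
  (F.bind σ).IsOpenPosMeasure

/-- Expected utility of individual `i` with true valuation `v` who reports `v'`, when the types of
the other individuals are drawn independently from `F` and are reported according to `σ`.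
(The `i`-th coordinate of `r` is overwritten, so that only the `n - 1` others are random.) -/
def expectedUtility {n m : ℕ} {vbar : ℝ} (M : Mechanism n m vbar)
    (F : Measure (valuations m vbar)) (σ : Kernel (valuations m vbar) (valuations m vbar))
    (i : Fin n) (v v' : valuations m vbar) : ℝ :=
  ∫ r, utility v (M (Function.update r i v') i) ∂(Measure.pi fun _ : Fin n => F.bind σ)

/-- Expected utility gain of individual `i` with true valuation `v` from reporting `v'`. -/
def expectedGain {n m : ℕ} {vbar : ℝ} (M : Mechanism n m vbar)
    (F : Measure (valuations m vbar)) (σ : Kernel (valuations m vbar) (valuations m vbar))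
    (i : Fin n) (v v' : valuations m vbar) : ℝ :=
  expectedUtility M F σ i v v' - expectedUtility M F σ i v v

/-- A mechanism (one allocation rule for each market size) is strategy-proof in the large. -/
def IsSPL {m : ℕ} {vbar : ℝ} (F : Measure (valuations m vbar))
    (M : ∀ n : ℕ, Mechanism n m vbar) : Prop :=
  ∀ σ : Kernel (valuations m vbar) (valuations m vbar), IsMarkovKernel σ → FullRange F σ →
    ∀ ε : ℝ, 0 < ε → ∃ N : ℕ, ∀ n : ℕ, N < n →
      ∀ (i : Fin n) (v v' : valuations m vbar), expectedGain (M n) F σ i v v' ≤ ε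

end CEEI

end

namespace CEEI

/-- Competitive equilibrium conditions from equal unit budgets: `u k` is the utility of individual
`k` and every individual spends the whole budget on items with the best value for money. -/
structure IsEquilibrium {n m : ℕ} (s : Fin m → ℝ) (w x : Fin n → Fin m → ℝ) (p : Fin m → ℝ) :
    Prop where
  nonneg : ∀ k j, 0 ≤ x k j
  utility_pos : ∀ k, 0 < utility (w k) (x k)
  price_nonneg : ∀ j, 0 ≤ p j
  le_price : ∀ k j, w k j ≤ p j * utility (w k) (x k)
  eq_price : ∀ k j, x k j * (p j * utility (w k) (x k)) = x k j * w k j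
  clearing : ∀ j, p j * ∑ k, x k j = p j * s j

theorem utility_combo {m : ℕ} (w x y : Fin m → ℝ) (a b : ℝ) :
    utility w (fun j => a * x j + b * y j) = a * utility w x + b * utility w y := by
  simp only [utility, Finset.mul_sum, ← Finset.sum_add_distrib]
  exact Finset.sum_congr rfl fun j _ => by ring

/-- First-order optimality condition for the Eisenberg-Gale program. -/
theorem IsEisenbergGale.sum_utility_div_le {n m : ℕ} {s : Fin m → ℝ} {w x : Fin n → Fin m → ℝ}
    (h : IsEisenbergGale s w x) (hw : ∀ i j, 0 ≤ w i j) {y : Fin n → Fin m → ℝ}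
    (hy : IsFeasible s y) :
    ∑ i, utility (w i) (y i) / utility (w i) (x i) ≤ n := by
  obtain ⟨hx, hpos, hopt⟩ := h
  have hyu : ∀ i, 0 ≤ utility (w i) (y i) := fun i =>
    Finset.sum_nonneg fun j _ => mul_nonneg (hw i j) (hy.1 i j)
  set a : Fin n → ℝ := fun i => utility (w i) (y i) / utility (w i) (x i) with ha
  have ha0 : ∀ i, 0 ≤ a i := fun i => div_nonneg (hyu i) (hpos i).le
  have key : ∀ t : ℝ, 0 < t → t < 1 → ∑ i, (a i - 1) / (1 - t + t * a i) ≤ 0 := by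
    intro t ht ht1
    have hd : ∀ i, 0 < 1 - t + t * a i := fun i => by
      have := mul_nonneg ht.le (ha0 i); linarith
    have hz : ∀ i, utility (w i) (fun j => (1 - t) * x i j + t * y i j)
        = utility (w i) (x i) * (1 - t + t * a i) := fun i => by
      rw [utility_combo]
      simp only [ha]
      field_simp [(hpos i).ne']
    have hle := hopt (fun i j => (1 - t) * x i j + t * y i j)
      ⟨fun i j => add_nonneg (mul_nonneg (by linarith) (hx.1 i j)) (mul_nonneg ht.le (hy.1 i j)),
        fun j => by
          rw [Finset.sum_add_distrib, ← Finset.mul_sum, ← Finset.mul_sum]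
          nlinarith [hx.2 j, hy.2 j]⟩
      fun i => by rw [hz]; exact mul_pos (hpos i) (hd i)
    simp only [hz] at hle
    have h1 : ∑ i, Real.log (1 - t + t * a i) ≤ 0 := by
      have : ∀ i, Real.log (utility (w i) (x i) * (1 - t + t * a i))
          = Real.log (utility (w i) (x i)) + Real.log (1 - t + t * a i) := fun i =>
        Real.log_mul (hpos i).ne' (hd i).ne'
      simp only [this, Finset.sum_add_distrib] at hle
      linarith
    have h2 : ∑ i, t * ((a i - 1) / (1 - t + t * a i)) ≤ ∑ i, Real.log (1 - t + t * a i) := by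
      refine Finset.sum_le_sum fun i _ => ?_
      have := Real.one_sub_inv_le_log_of_pos (hd i)
      refine le_trans (le_of_eq ?_) this
      have := (hd i).ne'
      field_simp
      ring
    rw [← Finset.mul_sum] at h2
    by_contra! hc
    have := mul_pos ht hc
    linarith
  have hlim : Filter.Tendsto (fun t : ℝ => ∑ i, (a i - 1) / (1 - t + t * a i))
      (nhdsWithin 0 (Set.Ioi 0)) (nhds (∑ i, (a i - 1) / (1 - 0 + 0 * a i))) := by
    refine tendsto_finsetSum _ fun i _ => Filter.Tendsto.div tendsto_const_nhds ?_ (by simp)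
    refine Filter.Tendsto.mono_left ?_ nhdsWithin_le_nhds
    exact Continuous.tendsto (by fun_prop) (0 : ℝ)
  have hfin := le_of_tendsto hlim (by
    filter_upwards [Ioo_mem_nhdsGT (show (0 : ℝ) < 1 by norm_num)] with t ht
    exact key t ht.1 ht.2)
  simp at hfin
  linarith

theorem IsEisenbergGale.exists_isEquilibrium {n m : ℕ} [NeZero n] {s : Fin m → ℝ}
    (hs : ∀ j, 0 ≤ s j) {w x : Fin n → Fin m → ℝ}
    (h : IsEisenbergGale s w x) (hw : ∀ i j, 0 ≤ w i j) :
    ∃ p, IsEquilibrium s w x p := by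
  have hpos := h.2.1
  choose f hf using fun j => Finite.exists_max fun i => w i j / utility (w i) (x i)
  set p : Fin m → ℝ := fun j => w (f j) j / utility (w (f j)) (x (f j)) with hp
  have hp0 : ∀ j, 0 ≤ p j := fun j => div_nonneg (hw _ _) (hpos _).le
  have hle : ∀ k j, w k j ≤ p j * utility (w k) (x k) := fun k j =>
    (div_le_iff₀ (hpos k)).1 (hf j k)
  have h1 : ∑ j, p j * s j ≤ n := by
    have := h.sum_utility_div_le hw (y := fun i j => if i = f j then s j else 0)
      ⟨fun i j => by dsimp only; split_ifs; exacts [hs j, le_rfl], fun j => by simp⟩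
    refine le_trans (le_of_eq ?_) this
    simp only [utility, Finset.sum_div]
    rw [Finset.sum_comm]
    refine Finset.sum_congr rfl fun j _ => ?_
    rw [Finset.sum_eq_single (f j)]
    · simp [hp, utility]; ring
    · intro b _ hb; simp [hb]
    · simp
  have h2 : ∑ k, ∑ j, x k j * (w k j / utility (w k) (x k)) = n := by
    have : ∀ k, ∑ j, x k j * (w k j / utility (w k) (x k)) = 1 := fun k => by
      rw [← div_self (hpos k).ne']
      conv_rhs => rw [utility, Finset.sum_div]
      exact Finset.sum_congr rfl fun j _ => by rw [utility]; ring
    simp [this]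
  have h3 : ∀ k j, x k j * (w k j / utility (w k) (x k)) ≤ x k j * p j := fun k j =>
    mul_le_mul_of_nonneg_left (hf j k) (h.1.1 k j)
  have h4 : ∑ k, ∑ j, x k j * p j = ∑ j, p j * ∑ k, x k j := by
    rw [Finset.sum_comm]
    exact Finset.sum_congr rfl fun j _ => by
      rw [Finset.mul_sum]; exact Finset.sum_congr rfl fun k _ => mul_comm _ _
  have h5 : ∀ j, p j * ∑ k, x k j ≤ p j * s j := fun j =>
    mul_le_mul_of_nonneg_left (h.1.2 j) (hp0 j)
  have h6 := Finset.sum_le_sum fun k (_ : k ∈ Finset.univ) =>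
    Finset.sum_le_sum fun j (_ : j ∈ Finset.univ) => h3 k j
  have h7 := Finset.sum_le_sum fun j (_ : j ∈ Finset.univ) => h5 j
  refine ⟨p, h.1.1, hpos, hp0, hle, fun k j => ?_, fun j => ?_⟩
  · have e := (Finset.sum_eq_sum_iff_of_le fun k _ => Finset.sum_le_sum
      fun j (_ : j ∈ Finset.univ) => h3 k j).1 (by linarith) k (Finset.mem_univ _)
    have e' := (Finset.sum_eq_sum_iff_of_le fun j _ => h3 k j).1 e j (Finset.mem_univ _)
    have := (hpos k).ne'
    rw [← mul_assoc, ← e']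
    field_simp
  · exact (Finset.sum_eq_sum_iff_of_le fun j _ => h5 j).1 (by linarith) j (Finset.mem_univ _)

namespace IsEquilibrium

variable {n m : ℕ} {s : Fin m → ℝ} {w x : Fin n → Fin m → ℝ} {p : Fin m → ℝ}

theorem spending (h : IsEquilibrium s w x p) (k : Fin n) : ∑ j, p j * x k j = 1 := by
  have hu := h.utility_pos k
  refine mul_right_cancel₀ hu.ne' ?_
  rw [one_mul, Finset.sum_mul]
  conv_rhs => rw [utility]
  exact Finset.sum_congr rfl fun j _ => by linear_combination h.eq_price k j

theorem sum_spending (h : IsEquilibrium s w x p) (j : Fin m) :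
    ∑ k, p j * x k j = p j * s j := by
  rw [← Finset.mul_sum, h.clearing]

theorem spending_le_one (h : IsEquilibrium s w x p) (k : Fin n) (j : Fin m) :
    p j * x k j ≤ 1 := by
  rw [← h.spending k]
  exact Finset.single_le_sum (f := fun j => p j * x k j)
    (fun j _ => mul_nonneg (h.price_nonneg j) (h.nonneg k j)) (Finset.mem_univ j)

theorem price_mul_supply_le (h : IsEquilibrium s w x p) (j : Fin m) : p j * s j ≤ n := by
  rw [← h.sum_spending j]
  simpa using Finset.sum_le_sum fun k (_ : k ∈ Finset.univ) => h.spending_le_one k j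

/-- If sufficiently many individuals like every item best, then all prices are bounded below. -/
theorem le_price_of_card (h : IsEquilibrium s w x p) {δ : ℝ} (S : Fin m → Finset (Fin n))
    (hs : ∀ j, 0 < s j) (hS : ∀ j, ∀ k ∈ S j, ∀ l, l ≠ j → w k l < w k j)
    (hcard : ∀ j, δ * s j ≤ (S j).card) (j : Fin m) : δ ≤ p j := by
  have : Nonempty (Fin m) := ⟨j⟩
  obtain ⟨j₀, hj₀⟩ := Finite.exists_min p
  refine le_trans ?_ (hj₀ j)
  refine le_of_mul_le_mul_right ?_ (hs j₀)
  refine (hcard j₀).trans ?_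
  have hone : ∀ k ∈ S j₀, p j₀ * x k j₀ = 1 := by
    intro k hk
    rw [← h.spending k, eq_comm]
    refine Finset.sum_eq_single j₀ (fun l _ hl => ?_) (by simp)
    by_cases hxl : x k l = 0
    · simp [hxl]
    have e := mul_left_cancel₀ hxl (h.eq_price k l)
    have h1 := hS j₀ k hk l hl
    have h2 := h.le_price k j₀
    have h3 := mul_le_mul_of_nonneg_right (hj₀ l) (h.utility_pos k).le
    linarith
  calc ((S j₀).card : ℝ) = ∑ k ∈ S j₀, p j₀ * x k j₀ := by simp [Finset.sum_congr rfl hone]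
    _ ≤ ∑ k, p j₀ * x k j₀ := Finset.sum_le_univ_sum_of_nonneg fun k =>
        mul_nonneg (h.price_nonneg _) (h.nonneg _ _)
    _ = p j₀ * s j₀ := h.sum_spending j₀

theorem sum_bundle_le (h : IsEquilibrium s w x p) {δ : ℝ} (hδ : 0 < δ) (hp : ∀ j, δ ≤ p j)
    (k : Fin n) : ∑ j, x k j ≤ 1 / δ := by
  rw [le_div_iff₀ hδ, ← h.spending k, Finset.sum_mul]
  exact Finset.sum_le_sum fun j _ => by
    rw [mul_comm]; exact mul_le_mul_of_nonneg_right (hp j) (h.nonneg k j)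

/-- Half of the monotonicity of an individual's spending in the logarithms of the prices. -/
theorem sum_spending_mul_log_le {w' x' : Fin n → Fin m → ℝ} {p' : Fin m → ℝ} {s' : Fin m → ℝ}
    (h : IsEquilibrium s w x p) (h' : IsEquilibrium s' w' x' p') (hp : ∀ j, 0 < p j)
    (hp' : ∀ j, 0 < p' j) {k : Fin n} (hk : w k = w' k) :
    ∑ j, p j * x k j * (Real.log (p j) - Real.log (p' j))
      ≤ Real.log (utility (w' k) (x' k)) - Real.log (utility (w k) (x k)) := by
  rw [← one_mul (Real.log (utility (w' k) (x' k)) - _), ← h.spending k, Finset.sum_mul]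
  refine Finset.sum_le_sum fun j _ => ?_
  by_cases hx : x k j = 0
  · simp [hx]
  refine mul_le_mul_of_nonneg_left ?_ (mul_nonneg (hp j).le (h.nonneg k j))
  have e := mul_left_cancel₀ hx (h.eq_price k j)
  have h2 := h'.le_price k j
  rw [← hk, ← e, hk] at h2
  have h3 := Real.log_le_log (mul_pos (hp j) (by rw [← hk]; exact h.utility_pos k)) h2
  rw [Real.log_mul (hp j).ne' (by rw [← hk]; exact (h.utility_pos k).ne'),
    Real.log_mul (hp' j).ne' (h'.utility_pos k).ne'] at h3
  rw [hk]
  linarith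

theorem monotone_spending {w' x' : Fin n → Fin m → ℝ} {p' : Fin m → ℝ} {s' : Fin m → ℝ}
    (h : IsEquilibrium s w x p) (h' : IsEquilibrium s' w' x' p') (hp : ∀ j, 0 < p j)
    (hp' : ∀ j, 0 < p' j) {k : Fin n} (hk : w k = w' k) :
    ∑ j, (p j * x k j - p' j * x' k j) * (Real.log (p j) - Real.log (p' j)) ≤ 0 := by
  have h1 := h.sum_spending_mul_log_le h' hp hp' hk
  have h2 := h'.sum_spending_mul_log_le h hp' hp hk.symm
  have : ∑ j, (p j * x k j - p' j * x' k j) * (Real.log (p j) - Real.log (p' j))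
      = ∑ j, p j * x k j * (Real.log (p j) - Real.log (p' j))
        + ∑ j, p' j * x' k j * (Real.log (p' j) - Real.log (p j)) := by
    rw [← Finset.sum_add_distrib]
    exact Finset.sum_congr rfl fun j _ => by ring
  linarith

theorem log_sub_log_le {a b δ : ℝ} (hδ : 0 < δ) (ha : δ ≤ a) (hb : δ ≤ b) :
    Real.log a - Real.log b ≤ |a - b| / δ := by
  have ha0 := hδ.trans_le ha
  have hb0 := hδ.trans_le hb
  rw [← Real.log_div ha0.ne' hb0.ne']
  refine (Real.log_le_sub_one_of_pos (div_pos ha0 hb0)).trans ?_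
  calc a / b - 1 = (a - b) / b := by field_simp
    _ ≤ |a - b| / b := by gcongr; exact le_abs_self _
    _ ≤ |a - b| / δ := by gcongr

theorem abs_log_sub_log_le {a b δ : ℝ} (hδ : 0 < δ) (ha : δ ≤ a) (hb : δ ≤ b) :
    |Real.log a - Real.log b| ≤ |a - b| / δ :=
  abs_le.2 ⟨by have := log_sub_log_le hδ hb ha; rw [abs_sub_comm] at this; linarith,
    log_sub_log_le hδ ha hb⟩

theorem mul_sq_le_sub_mul_log {a b c : ℝ} (ha : 0 < a) (hb : 0 < b)
    (hac : a * c ≤ 1) (hbc : b * c ≤ 1) :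
    c * (a - b) ^ 2 ≤ (a - b) * (Real.log a - Real.log b) := by
  wlog hab : b ≤ a generalizing a b
  · have := this hb ha hbc hac (not_le.1 hab).le
    nlinarith
  rw [← Real.log_div ha.ne' hb.ne']
  have h1 := Real.one_sub_inv_le_log_of_pos (div_pos ha hb)
  have h2 : c * (a - b) ≤ 1 - (a / b)⁻¹ := by
    rw [inv_div, one_sub_div ha.ne', le_div_iff₀ ha]
    nlinarith
  nlinarith

/-- Equilibrium prices move by `O(1 / n)` when a single individual changes the report. -/
theorem abs_price_sub_le {c : Fin m → ℝ} {c₀ δ : ℝ} (hc₀ : 0 < c₀) (hc : ∀ j, c₀ ≤ c j)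
    (hδ : 0 < δ) {w' x' : Fin n → Fin m → ℝ} {p' : Fin m → ℝ} {i : Fin n}
    (h : IsEquilibrium (fun j => c j * n) w x p) (h' : IsEquilibrium (fun j => c j * n) w' x' p')
    (hw : ∀ k, k ≠ i → w k = w' k) (hp : ∀ j, δ ≤ p j) (hp' : ∀ j, δ ≤ p' j) (j : Fin m) :
    |p j - p' j| ≤ 2 / (δ * c₀ ^ 2) / n := by
  have hn : (0 : ℝ) < n := by exact_mod_cast i.pos
  have hp0 : ∀ j, 0 < p j := fun j => hδ.trans_le (hp j)
  have hp0' : ∀ j, 0 < p' j := fun j => hδ.trans_le (hp' j)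
  have : Nonempty (Fin m) := ⟨j⟩
  obtain ⟨l, hl⟩ := Finite.exists_max fun j => |p j - p' j|
  refine (hl j).trans ?_
  set D := |p l - p' l| with hD
  set Q : Fin m → ℝ := fun j => Real.log (p j) - Real.log (p' j) with hQ
  have hcj : ∀ j, 0 < c j := fun j => hc₀.trans_le (hc j)
  have hpc : ∀ j, p j * c j ≤ 1 := fun j => by
    have := h.price_mul_supply_le j
    rw [← mul_assoc] at this
    exact le_of_mul_le_mul_right (by simpa using this) hn
  have hpc' : ∀ j, p' j * c j ≤ 1 := fun j => by
    have := h'.price_mul_supply_le j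
    rw [← mul_assoc] at this
    exact le_of_mul_le_mul_right (by simpa using this) hn
  have hQle : ∀ j, |Q j| ≤ D / δ := fun j =>
    (abs_log_sub_log_le hδ (hp j) (hp' j)).trans (by gcongr; exact hl j)
  have hterm : ∀ j, c j * (c j * n) * (p j - p' j) ^ 2 ≤ (p j * (c j * n) - p' j * (c j * n)) * Q j :=
    fun j => by
      have := mul_sq_le_sub_mul_log (hp0 j) (hp0' j) (hpc j) (hpc' j)
      have := mul_le_mul_of_nonneg_left this (mul_pos (hcj j) hn).le
      simp only [hQ]
      linarith
  have hsum : ∑ j, (p j * (c j * n) - p' j * (c j * n)) * Q j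
      = ∑ k, ∑ j, (p j * x k j - p' j * x' k j) * Q j := by
    rw [Finset.sum_comm]
    refine Finset.sum_congr rfl fun j _ => ?_
    rw [← h.sum_spending j, ← h'.sum_spending j, ← Finset.sum_sub_distrib, Finset.sum_mul]
  have hsum' : ∑ k, ∑ j, (p j * x k j - p' j * x' k j) * Q j
      ≤ ∑ j, (p j * x i j - p' j * x' i j) * Q j := by
    rw [← Finset.add_sum_erase _ _ (Finset.mem_univ i)]
    have := Finset.sum_nonpos fun k (hk : k ∈ Finset.univ.erase i) =>
      h.monotone_spending h' hp0 hp0' (hw k (Finset.ne_of_mem_erase hk))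
    linarith
  have hi : ∑ j, (p j * x i j - p' j * x' i j) * Q j ≤ 2 * (D / δ) := by
    have : ∑ j, (p j * x i j + p' j * x' i j) * (D / δ) = 2 * (D / δ) := by
      rw [← Finset.sum_mul, Finset.sum_add_distrib, h.spending, h'.spending]; norm_num
    rw [← this]
    refine Finset.sum_le_sum fun j _ => ?_
    have h1 := mul_nonneg (h.price_nonneg j) (h.nonneg i j)
    have h2 := mul_nonneg (h'.price_nonneg j) (h'.nonneg i j)
    obtain ⟨h3, h4⟩ := abs_le.1 (hQle j)
    nlinarith
  have hone : c₀ ^ 2 * n * D ^ 2 ≤ ∑ j, (p j * (c j * n) - p' j * (c j * n)) * Q j := by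
    calc c₀ ^ 2 * n * D ^ 2 ≤ c l * (c l * n) * (p l - p' l) ^ 2 := by
          rw [hD, sq_abs, ← mul_assoc, ← sq]
          gcongr
          exact hc l
      _ ≤ ∑ j, c j * (c j * n) * (p j - p' j) ^ 2 :=
          Finset.single_le_sum (f := fun j => c j * (c j * n) * (p j - p' j) ^ 2)
            (fun j _ => by have := hcj j; positivity) (Finset.mem_univ l)
      _ ≤ _ := Finset.sum_le_sum fun j _ => hterm j
  have hfin : c₀ ^ 2 * n * D ^ 2 ≤ 2 * (D / δ) := by linarith
  rcases (abs_nonneg _ : 0 ≤ D).eq_or_lt with hD0 | hD0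
  · have : D = 0 := hD0.symm
    rw [this]; positivity
  rw [div_div, le_div_iff₀ (by positivity)]
  have h3 : c₀ ^ 2 * n * D * δ * D ≤ 2 * D := by
    have := mul_le_mul_of_nonneg_right hfin hδ.le
    rw [mul_assoc 2, div_mul_cancel₀ _ hδ.ne'] at this
    linarith
  have := le_of_mul_le_mul_right h3 hD0
  linarith

/-- The gain from a misreport at fixed reports of the others, if all prices are bounded below. -/
theorem gain_le {c : Fin m → ℝ} {c₀ δ vbar : ℝ} (hc₀ : 0 < c₀) (hc : ∀ j, c₀ ≤ c j)
    (hδ : 0 < δ) {w' x' : Fin n → Fin m → ℝ} {p' : Fin m → ℝ} {i : Fin n}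
    (h : IsEquilibrium (fun j => c j * n) w x p) (h' : IsEquilibrium (fun j => c j * n) w' x' p')
    (hw : ∀ k, k ≠ i → w k = w' k) (hp : ∀ j, δ ≤ p j) (hp' : ∀ j, δ ≤ p' j)
    (hv0 : 0 ≤ vbar) (hv : ∀ j, w i j ≤ vbar) :
    utility (w i) (x' i) - utility (w i) (x i)
      ≤ vbar * (1 / δ) * (2 / (δ * c₀ ^ 2) * (1 / δ)) / n := by
  set u := utility (w i) (x i) with hu
  have hu0 : 0 < u := h.utility_pos i
  have huv : u ≤ vbar * (1 / δ) := by
    calc u ≤ ∑ j, vbar * x i j :=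
          Finset.sum_le_sum fun j _ => mul_le_mul_of_nonneg_right (hv j) (h.nonneg i j)
      _ = vbar * ∑ j, x i j := by rw [Finset.mul_sum]
      _ ≤ _ := mul_le_mul_of_nonneg_left (h.sum_bundle_le hδ hp i) hv0
  set K := 2 / (δ * c₀ ^ 2) / n with hK
  have hK0 : 0 ≤ K := by positivity
  have h1 : utility (w i) (x' i) - u ≤ u * ∑ j, (p j - p' j) * x' i j := by
    have : utility (w i) (x' i) ≤ ∑ j, p j * u * x' i j :=
      Finset.sum_le_sum fun j _ => mul_le_mul_of_nonneg_right (h.le_price i j) (h'.nonneg i j)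
    have e : u * ∑ j, (p j - p' j) * x' i j
        = ∑ j, p j * u * x' i j - u * ∑ j, p' j * x' i j := by
      rw [Finset.mul_sum, Finset.mul_sum, ← Finset.sum_sub_distrib]
      exact Finset.sum_congr rfl fun j _ => by ring
    rw [h'.spending] at e
    linarith
  have h2 : ∑ j, (p j - p' j) * x' i j ≤ K * (1 / δ) := by
    calc ∑ j, (p j - p' j) * x' i j ≤ ∑ j, K * x' i j :=
          Finset.sum_le_sum fun j _ => mul_le_mul_of_nonneg_right
            ((le_abs_self _).trans (h.abs_price_sub_le hc₀ hc hδ h' hw hp hp' j)) (h'.nonneg i j)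
      _ = K * ∑ j, x' i j := by rw [Finset.mul_sum]
      _ ≤ _ := mul_le_mul_of_nonneg_left (h'.sum_bundle_le hδ hp' i) hK0
  calc _ ≤ u * ∑ j, (p j - p' j) * x' i j := h1
    _ ≤ u * (K * (1 / δ)) := mul_le_mul_of_nonneg_left h2 hu0.le
    _ ≤ vbar * (1 / δ) * (K * (1 / δ)) := mul_le_mul_of_nonneg_right huv (by positivity)
    _ = _ := by rw [hK]; ring

end IsEquilibrium

variable {m : ℕ} {vbar : ℝ}

/-- The reports that value item `j` strictly more than every other item. -/
def favouring (vbar : ℝ) (j : Fin m) : Set (valuations m vbar) :=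
  {w | ∀ l, l ≠ j → (w : Fin m → ℝ) l < (w : Fin m → ℝ) j}

theorem isOpen_favouring (j : Fin m) : IsOpen (favouring vbar j) := by
  have : favouring vbar j = ⋂ l, ⋂ (_ : l ≠ j),
      {w : valuations m vbar | (w : Fin m → ℝ) l < (w : Fin m → ℝ) j} := by
    ext w; simp [favouring]
  rw [this]
  have hcont (l : Fin m) : Continuous fun w : valuations m vbar => (w : Fin m → ℝ) l :=
    (continuous_apply l).comp continuous_subtype_val
  exact isOpen_iInter_of_finite fun l => isOpen_iInter_of_finite fun _ =>
    isOpen_lt (hcont l) (hcont j)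

theorem favouring_nonempty (hvbar : 0 < vbar) (j : Fin m) : (favouring vbar j).Nonempty := by
  refine ⟨⟨Pi.single j vbar, fun l => ?_, ?_⟩, fun l hl => ?_⟩
  · rcases eq_or_ne l j with rfl | hl
    · simpa using hvbar.le
    · simpa [hl] using hvbar.le
  · simpa using hvbar.ne'
  · simpa [hl] using hvbar

open Classical in
/-- Weight of a report in the exponential bound for the number of reports in `favouring vbar j`. -/
noncomputable def weight (j : Fin m) (w : valuations m vbar) : ℝ :=
  if w ∈ favouring vbar j then 1 / 2 else 1

theorem weight_pos (j : Fin m) (w : valuations m vbar) : 0 < weight j w := by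
  unfold weight; split_ifs <;> norm_num

theorem weight_le_one (j : Fin m) (w : valuations m vbar) : weight j w ≤ 1 := by
  unfold weight; split_ifs <;> norm_num

theorem measurable_weight (j : Fin m) : Measurable (weight (vbar := vbar) j) :=
  Measurable.ite (isOpen_favouring j).measurableSet measurable_const measurable_const

theorem integrable_weight (j : Fin m) (G : Measure (valuations m vbar)) [IsFiniteMeasure G] :
    Integrable (weight j) G :=
  Integrable.of_bound (measurable_weight j).aestronglyMeasurable 1
    (ae_of_all _ fun w => by
      rw [Real.norm_of_nonneg (weight_pos j w).le]; exact weight_le_one j w)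

theorem integral_weight (j : Fin m) (G : Measure (valuations m vbar)) [IsProbabilityMeasure G] :
    ∫ w, weight j w ∂G = 1 - G.real (favouring vbar j) / 2 := by
  have : weight (vbar := vbar) j
      = fun w => 1 - (favouring vbar j).indicator (fun _ => (1 / 2 : ℝ)) w := by
    ext w
    by_cases hw : w ∈ favouring vbar j <;> simp [weight, hw]
    norm_num
  rw [this, integral_sub (integrable_const _)
    ((integrable_const _).indicator (isOpen_favouring j).measurableSet),
    integral_indicator_const _ (isOpen_favouring j).measurableSet]
  simp [div_eq_mul_inv]

theorem one_le_exp_mul_prod_weight {n : ℕ} (j : Fin m) (r : Fin n → valuations m vbar) {q : ℝ}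
    (i : Fin n) (S : Finset (Fin n)) (hS : ∀ k, k ≠ i → r k ∈ favouring vbar j → k ∈ S)
    (hq : (S.card : ℝ) ≤ q) : 1 ≤ Real.exp (q + 1) * ∏ k, weight j (r k) := by
  classical
  have hw : (1 / 2 : ℝ) ^ (insert i S).card ≤ ∏ k, weight j (r k) := by
    rw [← Finset.prod_const, ← Finset.prod_mul_prod_compl (insert i S) fun k => weight j (r k)]
    have h1 : ∏ k ∈ (insert i S)ᶜ, weight j (r k) = 1 := Finset.prod_eq_one fun k hk => by
      simp only [Finset.mem_compl, Finset.mem_insert, not_or] at hk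
      exact if_neg fun h => hk.2 (hS k hk.1 h)
    rw [h1, mul_one]
    refine Finset.prod_le_prod (fun _ _ => by norm_num) fun k _ => ?_
    unfold weight; split_ifs <;> norm_num
  have he : (2 : ℝ) ^ (insert i S).card ≤ Real.exp (q + 1) := by
    calc (2 : ℝ) ^ (insert i S).card ≤ Real.exp 1 ^ (insert i S).card := by
          gcongr; linarith [Real.add_one_le_exp (1 : ℝ)]
      _ = Real.exp (insert i S).card := by rw [← Real.exp_nat_mul, mul_one]
      _ ≤ _ := Real.exp_le_exp.2 (by
          have : ((insert i S).card : ℝ) ≤ S.card + 1 := by exact_mod_cast Finset.card_insert_le i S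
          linarith)
  calc (1 : ℝ) = 2 ^ (insert i S).card * (1 / 2) ^ (insert i S).card := by
        rw [← mul_pow]; norm_num
    _ ≤ _ := mul_le_mul he hw (by positivity) (Real.exp_pos _).le

theorem utility_nonneg {v x : Fin m → ℝ} (hv : ∀ j, 0 ≤ v j) (hx : ∀ j, 0 ≤ x j) :
    0 ≤ utility v x :=
  Finset.sum_nonneg fun j _ => mul_nonneg (hv j) (hx j)

theorem IsFeasible.utility_le {n : ℕ} {c : Fin m → ℝ} {x : Fin n → Fin m → ℝ}
    (hx : IsFeasible (fun j => c j * n) x) (v : valuations m vbar) (i : Fin n) :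
    utility v (x i) ≤ vbar * (∑ j, c j) * n := by
  rw [mul_assoc, Finset.sum_mul, Finset.mul_sum]
  refine Finset.sum_le_sum fun j _ => ?_
  have h1 : x i j ≤ c j * n :=
    (Finset.single_le_sum (f := fun k => x k j) (fun k _ => hx.1 k j) (Finset.mem_univ i)).trans
      (hx.2 j)
  exact mul_le_mul (v.2.1 j).2 h1 (hx.1 i j) ((v.2.1 j).1.trans (v.2.1 j).2)

/-- Bound on the gain at fixed reports of the others, in good and in bad cases. -/
theorem IsCEEI.gain_le {n : ℕ} {c : Fin m → ℝ} {M : Mechanism n m vbar} (hM : IsCEEI c M)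
    (hvbar : 0 < vbar) {c₀ q δ : ℝ} (hc₀ : 0 < c₀) (hc : ∀ j, c₀ ≤ c j) (hδ : 0 < δ)
    (hδq : ∀ j, δ * c j ≤ q) (i : Fin n) (v v' : valuations m vbar)
    (r : Fin n → valuations m vbar) :
    utility v (M (Function.update r i v') i) - utility v (M (Function.update r i v) i)
      ≤ vbar * (1 / δ) * (2 / (δ * c₀ ^ 2) * (1 / δ)) / n
        + vbar * (∑ j, c j) * n * ∑ j, Real.exp (q * n + 1) * ∏ k, weight j (r k) := by
  classical
  have hn : (0 : ℝ) < n := by exact_mod_cast i.pos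
  have : NeZero n := ⟨i.pos.ne'⟩
  have hcj : ∀ j, 0 < c j := fun j => hc₀.trans_le (hc j)
  have hc_sum : 0 ≤ ∑ j, c j := Finset.sum_nonneg fun j _ => (hcj j).le
  have hw0 : ∀ j, 0 ≤ Real.exp (q * n + 1) * ∏ k, weight j (r k) := fun j =>
    mul_nonneg (Real.exp_pos _).le (Finset.prod_nonneg fun k _ => (weight_pos j _).le)
  set S : Fin m → Finset (Fin n) := fun j =>
    Finset.univ.filter fun k => k ≠ i ∧ r k ∈ favouring vbar j with hS
  by_cases hgood : ∀ j, δ * (c j * n) ≤ (S j).card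
  · have eq (a : valuations m vbar) :=
      (hM.optimal (Function.update r i a)).exists_isEquilibrium
        (fun j => mul_nonneg (hcj j).le hn.le) fun k j =>
          ((Function.update r i a k).2.1 j).1
    obtain ⟨p, hp⟩ := eq v
    obtain ⟨p', hp'⟩ := eq v'
    have hSmem (a : valuations m vbar) : ∀ j, ∀ k ∈ S j, ∀ l, l ≠ j →
        (Function.update r i a k : Fin m → ℝ) l < (Function.update r i a k : Fin m → ℝ) j := by
      intro j k hk
      obtain ⟨hki, hk⟩ := (Finset.mem_filter.1 hk).2
      rw [Function.update_of_ne hki]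
      exact hk
    have hsup : ∀ j, 0 < c j * n := fun j => mul_pos (hcj j) hn
    have := hp.gain_le hc₀ hc hδ hp' (i := i)
      (fun k hk => by rw [Function.update_of_ne hk, Function.update_of_ne hk])
      (hp.le_price_of_card S hsup (hSmem v) hgood) (hp'.le_price_of_card S hsup (hSmem v') hgood)
      hvbar.le (fun j => ((Function.update r i v i).2.1 j).2)
    simp only [Function.update_self] at this
    refine this.trans (le_add_of_nonneg_right ?_)
    exact mul_nonneg (by positivity) (Finset.sum_nonneg fun j _ => hw0 j)
  · push Not at hgood
    obtain ⟨j, hj⟩ := hgood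
    have h1 := one_le_exp_mul_prod_weight (q := q * n) j r i (S j)
      (fun k hk hkj => by simp [hS, hk, hkj])
      (hj.le.trans (by rw [← mul_assoc]; exact mul_le_mul_of_nonneg_right (hδq j) hn.le))
    have h2 := h1.trans (Finset.single_le_sum (fun j _ => hw0 j) (Finset.mem_univ j))
    have h3 := (hM.optimal (Function.update r i v')).1.utility_le v i
    have h4 := utility_nonneg (fun j => (v.2.1 j).1)
      ((hM.optimal (Function.update r i v)).1.1 i)
    have h5 := mul_le_mul_of_nonneg_left h2 (show 0 ≤ vbar * (∑ j, c j) * n by positivity)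
    have h6 : 0 ≤ vbar * (1 / δ) * (2 / (δ * c₀ ^ 2) * (1 / δ)) / n := by positivity
    linarith

theorem IsCEEI.integrable_utility {n : ℕ} {c : Fin m → ℝ} {M : Mechanism n m vbar}
    (hM : IsCEEI c M) (G : Measure (valuations m vbar)) [IsProbabilityMeasure G] (i : Fin n)
    (v v' : valuations m vbar) :
    Integrable (fun r => utility v (M (Function.update r i v') i))
      (Measure.pi fun _ : Fin n => G) := by
  refine Integrable.of_bound (Measurable.aestronglyMeasurable ?_) (vbar * (∑ j, c j) * n)
    (ae_of_all _ fun r => ?_)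
  · have hup : Measurable fun r : Fin n → valuations m vbar => Function.update r i v' :=
      measurable_update_left
    refine Finset.measurable_fun_sum _ fun j _ => Measurable.const_mul ?_ _
    exact (measurable_pi_apply j).comp ((measurable_pi_apply i).comp (hM.measurable.comp hup))
  · have hf := (hM.optimal (Function.update r i v')).1
    rw [Real.norm_of_nonneg (utility_nonneg (fun j => (v.2.1 j).1) (hf.1 i))]
    exact hf.utility_le v i

/-- A family of positive reals indexed by a finite type has a positive lower bound. -/
theorem exists_pos_le {f : Fin m → ℝ} (hf : ∀ j, 0 < f j) : ∃ a, 0 < a ∧ ∀ j, a ≤ f j := by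
  rcases isEmpty_or_nonempty (Fin m) with _ | _
  · exact ⟨1, one_pos, isEmptyElim⟩
  · obtain ⟨j, hj⟩ := Finite.exists_min f
    exact ⟨f j, hf j, hj⟩

theorem exists_mul_pow_le_div {ρ : ℝ} (hρ0 : 0 ≤ ρ) (hρ : ρ < 1) :
    ∃ C : ℝ, ∀ n : ℕ, (n : ℝ) * ρ ^ n ≤ C / n := by
  obtain ⟨C, hC⟩ := (tendsto_pow_const_mul_const_pow_of_lt_one 2 hρ0 hρ).bddAbove_range
  refine ⟨C, fun n => ?_⟩
  rcases n.eq_zero_or_pos with rfl | hn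
  · simp
  rw [le_div_iff₀ (by exact_mod_cast hn)]
  have := hC ⟨n, rfl⟩
  simp only at this
  linarith

theorem exists_expectedGain_le (hvbar : 0 < vbar) {c : Fin m → ℝ} (hc : ∀ j, 0 < c j)
    (F : Measure (valuations m vbar)) [IsProbabilityMeasure F]
    (σ : Kernel (valuations m vbar) (valuations m vbar)) [IsMarkovKernel σ]
    (hσ : FullRange F σ) :
    ∃ C : ℝ, ∀ (n : ℕ) (M : Mechanism n m vbar), IsCEEI c M →
      ∀ (i : Fin n) (v v' : valuations m vbar), expectedGain M F σ i v v' ≤ C / n := by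
  have hG : IsProbabilityMeasure (F.bind σ) := inferInstance
  have hG' : (F.bind σ).IsOpenPosMeasure := hσ
  unfold expectedGain expectedUtility
  generalize F.bind σ = G at hG hG'
  obtain ⟨c₀, hc₀, hcc⟩ := exists_pos_le hc
  obtain ⟨g, hg, hgG⟩ := exists_pos_le (f := fun j => G.real (favouring vbar j)) fun j =>
    ENNReal.toReal_pos ((isOpen_favouring j).measure_pos G (favouring_nonempty hvbar j)).ne'
      (measure_ne_top _ _)
  have hsum : 0 ≤ ∑ j, c j := Finset.sum_nonneg fun j _ => (hc j).le
  obtain ⟨C, hC⟩ := exists_mul_pow_le_div (ρ := Real.exp (-(g / 4))) (Real.exp_pos _).le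
    (by rw [Real.exp_lt_one_iff]; linarith)
  set δ : ℝ := g / 4 / (1 + ∑ j, c j) with hδ
  have hδ0 : 0 < δ := by positivity
  have hδq : ∀ j, δ * c j ≤ g / 4 := fun j => by
    rw [hδ, div_mul_eq_mul_div]
    refine div_le_of_le_mul₀ (by positivity) (by positivity) ?_
    have := Finset.single_le_sum (fun j _ => (hc j).le) (Finset.mem_univ j)
    gcongr
    linarith
  set K : ℝ := vbar * (1 / δ) * (2 / (δ * c₀ ^ 2) * (1 / δ)) with hK
  set B : ℝ := vbar * ∑ j, c j with hB
  have hB0 : 0 ≤ B := by positivity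
  refine ⟨K + B * m * Real.exp 1 * C, fun n M hM i v v' => ?_⟩
  rw [← integral_sub (hM.integrable_utility G i v v') (hM.integrable_utility G i v v)]
  have hint : ∀ j, Integrable (fun r : Fin n → valuations m vbar =>
      Real.exp (g / 4 * n + 1) * ∏ k, weight j (r k)) (Measure.pi fun _ => G) := fun j =>
    (Integrable.fintype_prod fun _ => integrable_weight j G).const_mul _
  have hint' := (integrable_finsetSum Finset.univ fun j _ => hint j).const_mul (B * n)
  have hval : ∀ j, ∫ r : Fin n → valuations m vbar,
      Real.exp (g / 4 * n + 1) * ∏ k, weight j (r k) ∂(Measure.pi fun _ => G)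
        ≤ Real.exp 1 * Real.exp (-(g / 4)) ^ n := fun j => by
    rw [integral_const_mul, integral_fintype_prod_eq_pow, Fintype.card_fin]
    have h0 : 0 ≤ ∫ w, weight j w ∂G := integral_nonneg fun w => (weight_pos j w).le
    have h1 : ∫ w, weight j w ∂G ≤ Real.exp (-(g / 2)) := by
      have := hgG j
      have := Real.add_one_le_exp (-(g / 2))
      rw [integral_weight]
      linarith
    calc _ ≤ Real.exp (g / 4 * n + 1) * Real.exp (-(g / 2)) ^ n := by gcongr
      _ = _ := by
        rw [← Real.exp_nat_mul, ← Real.exp_nat_mul, ← Real.exp_add, ← Real.exp_add]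
        congr 1; ring
  calc _ ≤ ∫ r : Fin n → valuations m vbar, (K / n
          + B * n * ∑ j, Real.exp (g / 4 * n + 1) * ∏ k, weight j (r k))
          ∂(Measure.pi fun _ => G) :=
        integral_mono ((hM.integrable_utility G i v v').sub (hM.integrable_utility G i v v))
          ((integrable_const _).add hint')
          fun r => hM.gain_le hvbar hc₀ hcc hδ0 hδq i v v' r
    _ = K / n + B * n * ∑ j, ∫ r : Fin n → valuations m vbar,
          Real.exp (g / 4 * n + 1) * ∏ k, weight j (r k) ∂(Measure.pi fun _ => G) := by
        rw [integral_add (integrable_const _) hint', integral_const_mul,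
          integral_finsetSum _ fun j _ => hint j]
        simp
    _ ≤ K / n + B * n * ∑ _j : Fin m, Real.exp 1 * Real.exp (-(g / 4)) ^ n := by
        gcongr with j
        exact hval j
    _ = K / n + B * m * Real.exp 1 * (n * Real.exp (-(g / 4)) ^ n) := by
        simp only [Finset.sum_const, Finset.card_univ, Fintype.card_fin, nsmul_eq_mul]
        ring
    _ ≤ K / n + B * m * Real.exp 1 * (C / n) := by
        gcongr
        exact hC n
    _ = _ := by ring

end CEEI

theorem mainTheorem1 (m : ℕ) (vbar : ℝ) (hvbar : 0 < vbar)
    (c : Fin m → ℝ) (hc : ∀ j, 0 < c j)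
    (F : Measure (CEEI.valuations m vbar)) [IsProbabilityMeasure F] [F.IsOpenPosMeasure] :
    (∀ σ : Kernel (CEEI.valuations m vbar) (CEEI.valuations m vbar),
      IsMarkovKernel σ → CEEI.FullRange F σ →
        ∃ C : ℝ, ∀ (n : ℕ) (M : CEEI.Mechanism n m vbar), CEEI.IsCEEI c M →
          ∀ (i : Fin n) (v v' : CEEI.valuations m vbar),
            CEEI.expectedGain M F σ i v v' ≤ C / n) ∧
    (∀ M : (n : ℕ) → CEEI.Mechanism n m vbar,
      (∀ n, CEEI.IsCEEI c (M n)) → CEEI.IsSPL F M) := by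
  have main := fun (σ : Kernel (CEEI.valuations m vbar) (CEEI.valuations m vbar))
    (_ : IsMarkovKernel σ) (hF : CEEI.FullRange F σ) =>
      CEEI.exists_expectedGain_le hvbar hc F σ hF
  refine ⟨main, fun M hM σ hσ hF ε hε => ?_⟩
  obtain ⟨C, hC⟩ := main σ hσ hF
  obtain ⟨N, hN⟩ := Filter.eventually_atTop.1
    ((tendsto_const_div_atTop_nhds_zero_nat C).eventually (eventually_le_nhds hε))
  exact ⟨N, fun n hn i v v' => (hC n (M n) (hM n) i v v').trans (hN n hn.le)⟩
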